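/- Let $s\ge 1$. For $\ell\in\{1,\dots,s\}$ let $x_\ell(k+1)=A_\ell x_\ell(k)+B_\ell u_\ell(k)$ be a linear plant with $x_\ell(k)\in\mathbb R^{n_\ell}$, $u_\ell(k)\in\mathbb R^{m_\ell}$, and let $Q_\ell>0$, $R_\ell>0$ be symmetric weights and $\alpha_\ell\ge 0$. Put $$A_\ell^{(i)}=A_\ell^i,\qquad B_\ell^{(i)}=\sum_{q=0}^{i-1}A_\ell^qB_\ell,$$ $Q_\ell^{(1)}=Q_\ell$, $R_\ell^{(1)}=R_\ell$, $N_\ell^{(1)}=0$ and, for $i\ge2$, $$Q_\ell^{(i)}=Q_\ell^{(i-1)}+{A_\ell^{(i-1)}}^{T}Q_\ell A_\ell^{(i-1)},\quad R_\ell^{(i)}=R_\ell^{(i-1)}+{B_\ell^{(i-1)}}^{T}Q_\ell B_\ell^{(i-1)}+R_\ell,\quad N_\ell^{(i)}=N_\ell^{(i-1)}+{A_\ell^{(i-1)}}^{T}Q_\ell B_\ell^{(i-1)}.$$ Let $\mathcal I^0\subset\{1,2,\dots\}$ be finite with $\{1,\dots,s\}\subseteq\mathcal I^0$, let $\gamma=\max\mathcal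 I^0$ and $$p^*=\max\{i\in\mathcal I^0:\ \lambda^i\ne1\text{ for every }\ell\text{ and every eigenvalue }\lambda\neq1\text{ of }A_\ell\}.$$ Assume that $s\le p^*$ and that, for every $\ell$, the pairs $(A_\ell,B_\ell)$ and $(A_\ell^{(p^*)},B_\ell^{(p^*)})$ are controllable. Then for every $\ell$ there is exactly one positive semidefinite $P_\ell^{(p^*)}$ such that, with $$L_\ell^{(i)}=\big(R_\ell^{(i)}+{B_\ell^{(i)}}^{T}P_\ell^{(p^*)}B_\ell^{(i)}\big)^{-1}\big({A_\ell^{(i)}}^{T}P_\ell^{(p^*)}B_\ell^{(i)}+N_\ell^{(i)}\big)^{T},$$ the identity $$P_\ell^{(i)}=Q_\ell^{(i)}+{A_\ell^{(i)}}^{T}P_\ell^{(p^*)}A_\ell^{(i)}-\big({A_\ell^{(i)}}^{T}P_\ell^{(p^*)}B_\ell^{(i)}+N_\ell^{(i)}\big)L_\ell^{(i)}$$ holds for $i=p^*$; for the other $i\in\mathcal I^0$ take this identity as the definition of $P_\ell^{(i)}$. Write $\|x\|_P^2=x^TPx$. Consider the following algorithm with period $p^*$. All loops are sampled at time $0$ (and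 processed in the order $\ell=1,\dots,s$), and afterwards at their scheduled times. When loop $\ell$ is sampled at time $k$, its set of feasible waiting times is $$\mathcal I_\ell(k)=\{i\in\mathcal I^0:\ i\ne k_q^{\rm next}-k+rp^*\ \text{ for all } r\in\mathbb Z\text{ and all } q\neq\ell\},$$ where $k_q^{\rm next}$ is the next scheduled sampling time of loop $q$ (loops with nothing scheduled yet, at time $0$, impose no constraint). The controller chooses a minimizer $i$ of $\frac{\alpha_\ell}{i}+\|x_\ell(k)\|^2_{P_\ell^{(i)}}$ over $\mathcal I_\ell(k)$ (ties broken arbitrarily), applies the constant input $-L_\ell^{(i)}x_\ell(k)$ at times $k,\dots,k+i-1$, and schedules the next sample of loop $\ell$ at time $k+i$. For all initial states and every tie-breaking rule the algorithm can be run forever; the sets $\mathcal I_\ell(k)$ are nonempty and every loop is sampled infinitely often. For every $\ell$ there is a largest $\epsilon_\ell\in(0,1]$ with $$\big(A_\ell^{(i)}-B_\ell^{(i)}L_\ell^{(i)}\big)^{T}P_\ell^{(p^*)}\big(A_\ell^{(i)}-B_\ell^{(i)}L_\ell^{(i)}\big)\le(1-\epsilon_\ell)P_\ell^{(i)}\qquad\text{for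 all } i\in\mathcal I^0,$$ and, for every run, the optimal costs $V_\ell(k)=\min_{i\in\mathcal I_\ell(k)}\big(\frac{\alpha_\ell}{i}+\|x_\ell(k)\|^2_{P_\ell^{(i)}}\big)$ at the sampling instants $k$ of loop $\ell$ satisfy $$\frac{\alpha_\ell}{\gamma}\le V_\ell(k)\ \text{ for all such } k,\qquad \limsup_{k\to\infty}V_\ell(k)\le\frac{\alpha_\ell}{\epsilon_\ell}\Big(\frac1{p^*}-(1-\epsilon_\ell)\frac1\gamma\Big).$$ -/

import Mathlib

open scoped Matrix

noncomputable section

namespace SelfTriggered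

/-- The data of one control loop: the plant `x(k+1) = A x(k) + B u(k)` with `x ∈ ℝⁿ`, `u ∈ ℝᵐ`,
the weights `Q`, `R` of the quadratic cost, and the sampling-cost parameter `α`. -/
structure Loop where
  n : ℕ
  m : ℕ
  A : Matrix (Fin n) (Fin n) ℝ
  B : Matrix (Fin n) (Fin m) ℝ
  Q : Matrix (Fin n) (Fin n) ℝ
  R : Matrix (Fin m) (Fin m) ℝ
  α : ℝ

/-- Kalman's controllability matrix `[B, A B, …, A^{n-1} B]`. -/
def controllabilityMatrix {n m : ℕ} (A : Matrix (Fin n) (Fin n) ℝ)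
    (B : Matrix (Fin n) (Fin m) ℝ) : Matrix (Fin n) (Fin n × Fin m) ℝ :=
  Matrix.of fun a c => (A ^ (c.1 : ℕ) * B) a c.2

/-- The pair `(A, B)` is controllable (Kalman rank condition). -/
def Controllable {n m : ℕ} (A : Matrix (Fin n) (Fin n) ℝ) (B : Matrix (Fin n) (Fin m) ℝ) : Prop :=
  (controllabilityMatrix A B).rank = n

namespace Loop

variable (S : Loop)

/-- `A^{(i)} = A^i`. -/
def liftA (i : ℕ) : Matrix (Fin S.n) (Fin S.n) ℝ := S.A ^ i

/-- `B^{(i)} = ∑_{q < i} A^q B`. -/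
def liftB (i : ℕ) : Matrix (Fin S.n) (Fin S.m) ℝ := ∑ q ∈ Finset.range i, S.A ^ q * S.B

/-- `Q^{(i)} = Q^{(i-1)} + A^{(i-1)ᵀ} Q A^{(i-1)}`. The recursion is started from `0` at `i = 0`,
which gives `Q^{(1)} = Q`. -/
def liftQ : ℕ → Matrix (Fin S.n) (Fin S.n) ℝ
  | 0 => 0
  | i + 1 => liftQ i + (S.liftA i)ᵀ * S.Q * S.liftA i

/-- `R^{(i)} = R^{(i-1)} + B^{(i-1)ᵀ} Q B^{(i-1)} + R`. The recursion is started from `0` at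
`i = 0`, which gives `R^{(1)} = R`. -/
def liftR : ℕ → Matrix (Fin S.m) (Fin S.m) ℝ
  | 0 => 0
  | i + 1 => liftR i + (S.liftB i)ᵀ * S.Q * S.liftB i + S.R

/-- `N^{(i)} = N^{(i-1)} + A^{(i-1)ᵀ} Q B^{(i-1)}`. The recursion is started from `0` at `i = 0`,
which gives `N^{(1)} = 0`. -/
def liftN : ℕ → Matrix (Fin S.n) (Fin S.m) ℝ
  | 0 => 0
  | i + 1 => liftN i + (S.liftA i)ᵀ * S.Q * S.liftB i

/-- The optimal gain for one step of length `i` with terminal weight `P`: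
`(R^{(i)} + B^{(i)ᵀ} P B^{(i)})⁻¹ (A^{(i)ᵀ} P B^{(i)} + N^{(i)})ᵀ`. -/
def stepGain (i : ℕ) (P : Matrix (Fin S.n) (Fin S.n) ℝ) : Matrix (Fin S.m) (Fin S.n) ℝ :=
  (S.liftR i + (S.liftB i)ᵀ * P * S.liftB i)⁻¹ * ((S.liftA i)ᵀ * P * S.liftB i + S.liftN i)ᵀ

/-- One Riccati step of length `i` with terminal weight `P`:
`Q^{(i)} + A^{(i)ᵀ} P A^{(i)} - (A^{(i)ᵀ} P B^{(i)} + N^{(i)}) L`, with `L = S.stepGain i P`. -/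
def riccatiStep (i : ℕ) (P : Matrix (Fin S.n) (Fin S.n) ℝ) : Matrix (Fin S.n) (Fin S.n) ℝ :=
  S.liftQ i + (S.liftA i)ᵀ * P * S.liftA i
    - ((S.liftA i)ᵀ * P * S.liftB i + S.liftN i) * S.stepGain i P

/-- `P` is a positive semidefinite solution of the Riccati equation for sampling period `p`. -/
def IsRiccatiSolution (p : ℕ) (P : Matrix (Fin S.n) (Fin S.n) ℝ) : Prop :=
  P.PosSemidef ∧ P = S.riccatiStep p P

/-- The matrix `P^{(p)}`: the positive semidefinite solution of the Riccati equation for sampling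
period `p`. -/
def terminalP (p : ℕ) : Matrix (Fin S.n) (Fin S.n) ℝ :=
  Classical.epsilon (S.IsRiccatiSolution p)

/-- The matrix `P^{(i)}` for period `p`. -/
def P (p i : ℕ) : Matrix (Fin S.n) (Fin S.n) ℝ := S.riccatiStep i (S.terminalP p)

/-- The gain `L^{(i)}` for period `p`. -/
def L (p i : ℕ) : Matrix (Fin S.m) (Fin S.n) ℝ := S.stepGain i (S.terminalP p)

/-- The closed-loop matrix `A^{(i)} - B^{(i)} L^{(i)}` for period `p`. -/
def closedLoop (p i : ℕ) : Matrix (Fin S.n) (Fin S.n) ℝ := S.liftA i - S.liftB i * S.L p i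

/-- The cost `α / i + ‖x‖²_{P^{(i)}}` of waiting `i` steps from state `x`. -/
def cost (p : ℕ) (x : Fin S.n → ℝ) (i : ℕ) : ℝ := S.α / i + x ⬝ᵥ (S.P p i *ᵥ x)

open Classical in
/-- The set of minimizers of `α / i + ‖x‖²_{P^{(i)}}` over `i ∈ F`. -/
def minimizers (p : ℕ) (x : Fin S.n → ℝ) (F : Finset ℕ) : Finset ℕ :=
  F.filter fun i => ∀ j ∈ F, S.cost p x i ≤ S.cost p x j

/-- The minimum of `α / i + ‖x‖²_{P^{(i)}}` over `i ∈ F` (for nonempty `F`). -/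
def minCost (p : ℕ) (x : Fin S.n → ℝ) (F : Finset ℕ) : ℝ := sInf (S.cost p x '' (F : Set ℕ))

/-- The values in `(0, 1]` of the contraction parameter `e` for which
`(A^{(i)} - B^{(i)} L^{(i)})ᵀ P^{(p)} (A^{(i)} - B^{(i)} L^{(i)}) ≤ (1 - e) P^{(i)}`
holds for all `i ∈ I0`. -/
def contractionSet (p : ℕ) (I0 : Finset ℕ) : Set ℝ :=
  {e | 0 < e ∧ e ≤ 1 ∧ ∀ i ∈ I0,
    ((1 - e) • S.P p i - (S.closedLoop p i)ᵀ * S.P p p * S.closedLoop p i).PosSemidef}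

end Loop

/-- Here and below `next q k` is the next transmission time of sensor `q` that is on the schedule
once time instant `k` has been processed. Loop `ℓ` is sampled at time `0` (initialization) and at
every later time at which its sensor is scheduled to transmit. -/
def IsSampled {s : ℕ} (next : Fin s → ℕ → ℕ) (ℓ : Fin s) : ℕ → Prop
  | 0 => True
  | k + 1 => next ℓ k = k + 1

open Classical in
/-- The set of feasible waiting times of loop `ℓ` at time `k`: those `i ∈ I0` with
`i ≠ k_q^next - k + r p` for all integers `r` and all other loops `q`. At time `0` the loops are
processed in increasing order, so only the loops `q < ℓ` have a scheduled transmission. -/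
def feasible {s : ℕ} (I0 : Finset ℕ) (p : ℕ) (next : Fin s → ℕ → ℕ) (ℓ : Fin s) : ℕ → Finset ℕ
  | 0 => I0.filter fun i => ∀ q, q < ℓ → ∀ r : ℤ, (i : ℤ) ≠ (next q 0 : ℤ) - 0 + r * p
  | k + 1 => I0.filter fun i => ∀ q, q ≠ ℓ → ∀ r : ℤ,
      (i : ℤ) ≠ (next q k : ℤ) - ((k + 1 : ℕ) : ℤ) + r * p

/-- `(x, u, next)` is a run of the multiple loop self-triggered model predictive controller with
period `p`. Ties in the minimization may be broken arbitrarily. -/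
structure IsRun {s : ℕ} (loop : Fin s → Loop) (I0 : Finset ℕ) (p : ℕ)
    (x : ∀ ℓ, ℕ → Fin (loop ℓ).n → ℝ) (u : ∀ ℓ, ℕ → Fin (loop ℓ).m → ℝ)
    (next : Fin s → ℕ → ℕ) : Prop where
  /-- The plants evolve according to their dynamics. -/
  dynamics : ∀ ℓ k, x ℓ (k + 1) = (loop ℓ).A *ᵥ x ℓ k + (loop ℓ).B *ᵥ u ℓ k
  /-- At a sampling instant the controller picks an optimal feasible waiting time `i`, applies
  `-L^{(i)} x` and schedules the next sample `i` steps ahead. -/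
  sample : ∀ ℓ k, IsSampled next ℓ k →
    ∃ i ∈ (loop ℓ).minimizers p (x ℓ k) (feasible I0 p next ℓ k),
      next ℓ k = k + i ∧ u ℓ k = -((loop ℓ).L p i *ᵥ x ℓ k)
  /-- Between sampling instants the input and the schedule are kept. -/
  hold : ∀ ℓ k, ¬ IsSampled next ℓ (k + 1) → next ℓ (k + 1) = next ℓ k ∧ u ℓ (k + 1) = u ℓ k

end SelfTriggered

end

/-! The control part is dynamic programming. Holding one input for `i` steps costs a quadratic form
in state and input, and completing the square (`liftedCost_add_quadratic`) identifies `riccatiStep i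
P` with the least cost of such a hold under terminal weight `P`. Value iteration from `0` increases,
and it stays bounded because the lifted pair can be steered to the origin; its limit solves the
Riccati equation. Two solutions bound each other: along the optimal trajectory of one, the stage
costs are summable, so the terminal cost measured by the other vanishes. Each hold costs at least `x
⬝ᵥ (Q *ᵥ x)`, which is at least a fixed fraction of every form `P^{(i)}`; this gives a contraction
parameter.

The scheduling part is arithmetic modulo `p`. Since `s ≤ p`, the other loops cannot block all of `1,
…, s`. The pending sampling times stay pairwise distinct modulo `p` (`next_ne`), so a loop that is
sampled finds its own residue free and may wait exactly `p` steps (`period_mem_feasible`). Comparing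
the minimum with this choice gives `V(next) ≤ α/p + (1 - ε)(V - α/γ)` (`minCost_next_le`), an affine
contraction whose fixed point is the asserted asymptotic bound. -/

noncomputable section

namespace SelfTriggered

/-! ### Real quadratic forms. -/

section QuadraticForms

variable {n m : ℕ}

lemma dotProduct_symm_mulVec {M : Matrix (Fin n) (Fin n) ℝ} (hM : M.IsSymm) (x y : Fin n → ℝ) :
    x ⬝ᵥ (M *ᵥ y) = y ⬝ᵥ (M *ᵥ x) := by
  rw [Matrix.dotProduct_mulVec, ← Matrix.mulVec_transpose, hM.eq, dotProduct_comm]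

lemma dotProduct_transpose_mulVec (M : Matrix (Fin n) (Fin m) ℝ) (x : Fin m → ℝ)
    (y : Fin n → ℝ) : x ⬝ᵥ (Mᵀ *ᵥ y) = (M *ᵥ x) ⬝ᵥ y := by
  rw [Matrix.mulVec_transpose, dotProduct_comm, ← Matrix.dotProduct_mulVec, dotProduct_comm]

lemma transpose_mulVec_dotProduct (M : Matrix (Fin n) (Fin m) ℝ) (x : Fin m → ℝ)
    (y : Fin n → ℝ) : (Mᵀ *ᵥ y) ⬝ᵥ x = (M *ᵥ x) ⬝ᵥ y := by
  rw [dotProduct_comm, dotProduct_transpose_mulVec]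

lemma posSemidef_iff {M : Matrix (Fin n) (Fin n) ℝ} :
    M.PosSemidef ↔ M.IsSymm ∧ ∀ x, 0 ≤ x ⬝ᵥ (M *ᵥ x) := by
  rw [Matrix.posSemidef_iff_dotProduct_mulVec]
  simp [Matrix.IsHermitian, Matrix.IsSymm, Matrix.conjTranspose_eq_transpose_of_trivial]

lemma posDef_iff {M : Matrix (Fin n) (Fin n) ℝ} :
    M.PosDef ↔ M.IsSymm ∧ ∀ x, x ≠ 0 → 0 < x ⬝ᵥ (M *ᵥ x) := by
  rw [Matrix.posDef_iff_dotProduct_mulVec]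
  simp [Matrix.IsHermitian, Matrix.IsSymm, Matrix.conjTranspose_eq_transpose_of_trivial]

/-- This turns pointwise statements about quadratic forms into statements about matrix entries, both
for equality and for convergence. -/
lemma polarization {M : Matrix (Fin n) (Fin n) ℝ} (hM : M.IsSymm) (i j : Fin n) :
    M i j = ((Pi.single i 1 + Pi.single j 1) ⬝ᵥ (M *ᵥ (Pi.single i 1 + Pi.single j 1))
      - Pi.single i 1 ⬝ᵥ (M *ᵥ Pi.single i 1) - Pi.single j 1 ⬝ᵥ (M *ᵥ Pi.single j 1)) / 2 := by
  have h := dotProduct_symm_mulVec hM (Pi.single j 1) (Pi.single i 1)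
  simp only [Matrix.mulVec_add, dotProduct_add, add_dotProduct, h]
  simp
  ring

lemma eq_of_forall_quadratic_eq {M N : Matrix (Fin n) (Fin n) ℝ} (hM : M.IsSymm) (hN : N.IsSymm)
    (h : ∀ x, x ⬝ᵥ (M *ᵥ x) = x ⬝ᵥ (N *ᵥ x)) : M = N := by
  ext i j
  rw [polarization hM, polarization hN]
  simp only [h]

lemma continuous_quadratic (M : Matrix (Fin n) (Fin n) ℝ) :
    Continuous fun x : Fin n → ℝ => x ⬝ᵥ (M *ᵥ x) := by
  fun_prop

/-- Every quadratic form is dominated by a multiple of a positive definite one. -/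
lemma exists_quadratic_le {Q : Matrix (Fin n) (Fin n) ℝ} (hQ : Q.PosDef)
    (M : Matrix (Fin n) (Fin n) ℝ) :
    ∃ C : ℝ, 0 < C ∧ ∀ x, x ⬝ᵥ (M *ᵥ x) ≤ C * (x ⬝ᵥ (Q *ᵥ x)) := by
  have hpos := (posDef_iff.1 hQ).2
  have hne : ∀ y ∈ Metric.sphere (0 : Fin n → ℝ) 1, y ≠ 0 := by
    rintro y hy rfl
    simp at hy
  obtain ⟨C, hC⟩ := (isCompact_sphere (0 : Fin n → ℝ) 1).bddAbove_image
    (f := fun y => (y ⬝ᵥ (M *ᵥ y)) / (y ⬝ᵥ (Q *ᵥ y)))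
    ((continuous_quadratic M).continuousOn.div (continuous_quadratic Q).continuousOn
      fun y hy => (hpos y (hne y hy)).ne')
  -- The bound `C` on the sphere may be nonpositive; `|C| + 1` is positive and still dominates it.
  refine ⟨|C| + 1, by positivity, fun x => ?_⟩
  rcases eq_or_ne x 0 with rfl | hx
  · simp
  have hx' : ‖x‖ ≠ 0 := norm_ne_zero_iff.2 hx
  have hy : ‖x‖⁻¹ • x ∈ Metric.sphere (0 : Fin n → ℝ) 1 := by
    simp [norm_smul, hx']
  have h1 := hC ⟨_, hy, rfl⟩
  have hq : ∀ K : Matrix (Fin n) (Fin n) ℝ, (‖x‖⁻¹ • x) ⬝ᵥ (K *ᵥ (‖x‖⁻¹ • x))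
      = ‖x‖⁻¹ ^ 2 * (x ⬝ᵥ (K *ᵥ x)) := fun K => by
    simp [Matrix.mulVec_smul]; ring
  simp only [hq] at h1
  rw [mul_div_mul_left _ _ (by positivity), div_le_iff₀ (hpos x hx)] at h1
  nlinarith [hpos x hx, le_abs_self C]

end QuadraticForms

/-! ### Cost of a held input and the Riccati step. -/

namespace Loop

variable (S : Loop)

/-- The cost accumulated over `i` steps from `x` under the constant input `u`. -/
def liftedCost (i : ℕ) (x : Fin S.n → ℝ) (u : Fin S.m → ℝ) : ℝ :=
  x ⬝ᵥ (S.liftQ i *ᵥ x) + 2 * (x ⬝ᵥ (S.liftN i *ᵥ u)) + u ⬝ᵥ (S.liftR i *ᵥ u)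

/-- The state reached from `x` after `i` steps under the constant input `u`. -/
def liftedState (i : ℕ) (x : Fin S.n → ℝ) (u : Fin S.m → ℝ) : Fin S.n → ℝ :=
  S.liftA i *ᵥ x + S.liftB i *ᵥ u

variable {S}

lemma liftedState_succ (i : ℕ) (x : Fin S.n → ℝ) (u : Fin S.m → ℝ) :
    S.liftedState (i + 1) x u = S.A *ᵥ S.liftedState i x u + S.B *ᵥ u := by
  have hB : S.liftB (i + 1) = S.A * S.liftB i + S.B := by
    simp only [liftB, Finset.sum_range_succ', pow_zero, Matrix.one_mul, Matrix.mul_sum,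
      pow_succ', Matrix.mul_assoc]
  simp only [liftedState, hB, liftA, pow_succ', Matrix.mulVec_add, Matrix.add_mulVec,
    Matrix.mulVec_mulVec]
  abel

lemma isSymm_transpose_mul_mul {n m : ℕ} {M : Matrix (Fin n) (Fin n) ℝ} (hM : M.IsSymm)
    (C : Matrix (Fin n) (Fin m) ℝ) : (Cᵀ * M * C).IsSymm := by
  simp [Matrix.IsSymm, Matrix.transpose_mul, hM.eq, Matrix.mul_assoc]

lemma liftQ_isSymm (hQ : S.Q.IsSymm) : ∀ i, (S.liftQ i).IsSymm
  | 0 => by simp [liftQ]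
  | i + 1 => (liftQ_isSymm hQ i).add (isSymm_transpose_mul_mul hQ _)

lemma liftR_isSymm (hQ : S.Q.IsSymm) (hR : S.R.IsSymm) : ∀ i, (S.liftR i).IsSymm
  | 0 => by simp [liftR]
  | i + 1 => ((liftR_isSymm hQ hR i).add (isSymm_transpose_mul_mul hQ _)).add hR

lemma liftedCost_zero (x : Fin S.n → ℝ) (u : Fin S.m → ℝ) : S.liftedCost 0 x u = 0 := by
  simp [liftedCost, liftQ, liftN, liftR]

lemma liftedState_zero (x : Fin S.n → ℝ) (u : Fin S.m → ℝ) : S.liftedState 0 x u = x := by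
  simp [liftedState, liftA, liftB]

lemma quadratic_liftedState {M : Matrix (Fin S.n) (Fin S.n) ℝ} (hM : M.IsSymm) (i : ℕ)
    (x : Fin S.n → ℝ) (u : Fin S.m → ℝ) :
    S.liftedState i x u ⬝ᵥ (M *ᵥ S.liftedState i x u) =
      x ⬝ᵥ (((S.liftA i)ᵀ * M * S.liftA i) *ᵥ x)
      + 2 * (x ⬝ᵥ (((S.liftA i)ᵀ * M * S.liftB i) *ᵥ u))
      + u ⬝ᵥ (((S.liftB i)ᵀ * M * S.liftB i) *ᵥ u) := by
  have h := dotProduct_symm_mulVec hM (S.liftB i *ᵥ u) (S.liftA i *ᵥ x)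
  simp only [liftedState, Matrix.mulVec_add, dotProduct_add, add_dotProduct, h,
    ← Matrix.mulVec_mulVec, dotProduct_transpose_mulVec]
  ring

/-- The recursions for `liftQ`, `liftN` and `liftR` collect the coefficients of this stage cost;
this is what makes `liftedCost` the accumulated cost. -/
lemma liftedCost_succ (hQ : S.Q.IsSymm) (i : ℕ) (x : Fin S.n → ℝ) (u : Fin S.m → ℝ) :
    S.liftedCost (i + 1) x u = S.liftedCost i x u
      + S.liftedState i x u ⬝ᵥ (S.Q *ᵥ S.liftedState i x u) + u ⬝ᵥ (S.R *ᵥ u) := by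
  rw [quadratic_liftedState hQ]
  simp only [liftedCost, liftQ, liftN, liftR, Matrix.add_mulVec, dotProduct_add]
  ring

lemma le_liftedCost (hQ : S.Q.PosDef) (hR : S.R.PosDef) {i : ℕ} (hi : 1 ≤ i)
    (x : Fin S.n → ℝ) (u : Fin S.m → ℝ) :
    x ⬝ᵥ (S.Q *ᵥ x) + u ⬝ᵥ (S.R *ᵥ u) ≤ S.liftedCost i x u := by
  have hQs := (posDef_iff.1 hQ).1
  induction i, hi using Nat.le_induction with
  | base => simp [liftedCost_succ hQs, liftedCost_zero, liftedState_zero]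
  | succ i _ ih =>
    rw [liftedCost_succ hQs]
    linarith [(posSemidef_iff.1 hQ.posSemidef).2 (S.liftedState i x u),
      (posSemidef_iff.1 hR.posSemidef).2 u]

lemma liftedCost_nonneg (hQ : S.Q.PosDef) (hR : S.R.PosDef) {i : ℕ} (hi : 1 ≤ i)
    (x : Fin S.n → ℝ) (u : Fin S.m → ℝ) : 0 ≤ S.liftedCost i x u := by
  linarith [le_liftedCost hQ hR hi x u, (posSemidef_iff.1 hQ.posSemidef).2 x,
      (posSemidef_iff.1 hR.posSemidef).2 u]

/-- At `x = 0` the lifted cost reduces to the form of `liftR i`, which the first stage bounds below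
by that of `R`. -/
lemma liftR_posDef (hQ : S.Q.PosDef) (hR : S.R.PosDef) {i : ℕ} (hi : 1 ≤ i) :
    (S.liftR i).PosDef := by
  refine posDef_iff.2 ⟨liftR_isSymm (posDef_iff.1 hQ).1 (posDef_iff.1 hR).1 i, fun u hu => ?_⟩
  have h := le_liftedCost hQ hR hi 0 u
  have h' := (posDef_iff.1 hR).2 u hu
  simp only [liftedCost, zero_dotProduct] at h
  linarith

lemma weight_posDef (hQ : S.Q.PosDef) (hR : S.R.PosDef) {i : ℕ} (hi : 1 ≤ i)
    {P : Matrix (Fin S.n) (Fin S.n) ℝ} (hP : P.PosSemidef) :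
    (S.liftR i + (S.liftB i)ᵀ * P * S.liftB i).PosDef := by
  refine (liftR_posDef hQ hR hi).add_posSemidef ?_
  simpa [Matrix.conjTranspose_eq_transpose_of_trivial] using
    hP.conjTranspose_mul_mul_same (S.liftB i)

lemma weight_mul_stepGain (hQ : S.Q.PosDef) (hR : S.R.PosDef) {i : ℕ} (hi : 1 ≤ i)
    {P : Matrix (Fin S.n) (Fin S.n) ℝ} (hP : P.PosSemidef) :
    (S.liftR i + (S.liftB i)ᵀ * P * S.liftB i) * S.stepGain i P =
      ((S.liftA i)ᵀ * P * S.liftB i + S.liftN i)ᵀ := by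
  rw [stepGain, Matrix.mul_nonsing_inv_cancel_left]
  exact (Matrix.isUnit_iff_isUnit_det _).1 (weight_posDef hQ hR hi hP).isUnit

/-- Completion of the square in the Riccati step. -/
lemma liftedCost_add_quadratic (hQ : S.Q.PosDef) (hR : S.R.PosDef) {i : ℕ} (hi : 1 ≤ i)
    {P : Matrix (Fin S.n) (Fin S.n) ℝ} (hP : P.PosSemidef) (x : Fin S.n → ℝ)
    (u : Fin S.m → ℝ) :
    S.liftedCost i x u + S.liftedState i x u ⬝ᵥ (P *ᵥ S.liftedState i x u) =
      x ⬝ᵥ (S.riccatiStep i P *ᵥ x) + (u + S.stepGain i P *ᵥ x) ⬝ᵥ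
        ((S.liftR i + (S.liftB i)ᵀ * P * S.liftB i) *ᵥ (u + S.stepGain i P *ᵥ x)) := by
  have hG := weight_mul_stepGain hQ hR hi hP
  have hGs := (posDef_iff.1 (weight_posDef hQ hR hi hP)).1
  have h1 : (S.liftR i + (S.liftB i)ᵀ * P * S.liftB i) *ᵥ (S.stepGain i P *ᵥ x) =
      ((S.liftA i)ᵀ * P * S.liftB i + S.liftN i)ᵀ *ᵥ x := by
    rw [Matrix.mulVec_mulVec, hG]
  have h2 := dotProduct_symm_mulVec hGs (S.stepGain i P *ᵥ x) u
  rw [quadratic_liftedState (posSemidef_iff.1 hP).1, Matrix.mulVec_add, h1]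
  rw [h1] at h2
  simp only [dotProduct_add, add_dotProduct, h2]
  simp only [dotProduct_transpose_mulVec, liftedCost, riccatiStep, Matrix.add_mulVec,
    Matrix.sub_mulVec, dotProduct_add, dotProduct_sub, add_dotProduct, ← Matrix.mulVec_mulVec]
  simp only [dotProduct_comm x, transpose_mulVec_dotProduct]
  ring

lemma riccatiStep_isSymm (hQ : S.Q.PosDef) (hR : S.R.PosDef) {i : ℕ} (hi : 1 ≤ i)
    {P : Matrix (Fin S.n) (Fin S.n) ℝ} (hP : P.PosSemidef) : (S.riccatiStep i P).IsSymm := by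
  have hGs := (posDef_iff.1 (weight_posDef hQ hR hi hP)).1
  refine ((liftQ_isSymm (posDef_iff.1 hQ).1 i).add
    (isSymm_transpose_mul_mul (posSemidef_iff.1 hP).1 _)).sub ?_
  rw [stepGain, ← Matrix.mul_assoc]
  generalize S.liftR i + (S.liftB i)ᵀ * P * S.liftB i = G at hGs ⊢
  simp only [Matrix.IsSymm, Matrix.transpose_mul, Matrix.transpose_transpose,
    Matrix.transpose_nonsing_inv, hGs.eq, Matrix.mul_assoc]

/-- The square left over in `liftedCost_add_quadratic` is nonnegative, and it vanishes for the
feedback input of `riccatiStep_eq`: together these are the Bellman equation for one hold. -/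
lemma riccatiStep_le (hQ : S.Q.PosDef) (hR : S.R.PosDef) {i : ℕ} (hi : 1 ≤ i)
    {P : Matrix (Fin S.n) (Fin S.n) ℝ} (hP : P.PosSemidef) (x : Fin S.n → ℝ)
    (u : Fin S.m → ℝ) :
    x ⬝ᵥ (S.riccatiStep i P *ᵥ x) ≤
      S.liftedCost i x u + S.liftedState i x u ⬝ᵥ (P *ᵥ S.liftedState i x u) := by
  rw [liftedCost_add_quadratic hQ hR hi hP]
  linarith [(posSemidef_iff.1 (weight_posDef hQ hR hi hP).posSemidef).2
    (u + S.stepGain i P *ᵥ x)]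

lemma riccatiStep_eq (hQ : S.Q.PosDef) (hR : S.R.PosDef) {i : ℕ} (hi : 1 ≤ i)
    {P : Matrix (Fin S.n) (Fin S.n) ℝ} (hP : P.PosSemidef) (x : Fin S.n → ℝ) :
    x ⬝ᵥ (S.riccatiStep i P *ᵥ x) =
      S.liftedCost i x (-(S.stepGain i P *ᵥ x)) +
        S.liftedState i x (-(S.stepGain i P *ᵥ x)) ⬝ᵥ
          (P *ᵥ S.liftedState i x (-(S.stepGain i P *ᵥ x))) := by
  rw [liftedCost_add_quadratic hQ hR hi hP]
  simp

lemma riccatiStep_posSemidef (hQ : S.Q.PosDef) (hR : S.R.PosDef) {i : ℕ} (hi : 1 ≤ i)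
    {P : Matrix (Fin S.n) (Fin S.n) ℝ} (hP : P.PosSemidef) :
    (S.riccatiStep i P).PosSemidef := by
  refine posSemidef_iff.2 ⟨riccatiStep_isSymm hQ hR hi hP, fun x => ?_⟩
  rw [riccatiStep_eq hQ hR hi hP]
  exact add_nonneg (liftedCost_nonneg hQ hR hi _ _) ((posSemidef_iff.1 hP).2 _)

end Loop

end SelfTriggered

end

/-! ### Reachability for controllable pairs. -/

noncomputable section

namespace SelfTriggered

/-- Under the Kalman rank condition every vector is in the range of the controllability matrix. -/
lemma Controllable.exists_mulVec_eq {n m : ℕ} {A : Matrix (Fin n) (Fin n) ℝ}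
    {B : Matrix (Fin n) (Fin m) ℝ} (h : Controllable A B) (v : Fin n → ℝ) :
    ∃ c, controllabilityMatrix A B *ᵥ c = v := by
  have : LinearMap.range (controllabilityMatrix A B).mulVecLin = ⊤ := by
    apply Submodule.eq_top_of_finrank_eq
    simpa [Controllable, Matrix.rank] using h
  exact LinearMap.range_eq_top.1 this v

/-- Under the Kalman rank condition every vector is reached from the origin in `n` steps. -/
lemma Controllable.exists_sum_eq {n m : ℕ} {A : Matrix (Fin n) (Fin n) ℝ}
    {B : Matrix (Fin n) (Fin m) ℝ} (h : Controllable A B) (v : Fin n → ℝ) :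
    ∃ w : ℕ → Fin m → ℝ, ∑ q ∈ Finset.range n, (A ^ q * B) *ᵥ w (n - 1 - q) = v := by
  obtain ⟨c, hc⟩ := h.exists_mulVec_eq v
  -- Time runs against the power of `A`: the input at time `k` is multiplied by `A ^ (n - 1 - k)`.
  -- The default `0` is never used by the sum.
  refine ⟨fun k b => if hk : n - 1 - k < n then c (⟨n - 1 - k, hk⟩, b) else 0, ?_⟩
  rw [← hc, Finset.sum_range]
  ext a
  simp only [Finset.sum_apply, Matrix.mulVec, dotProduct, controllabilityMatrix, Matrix.of_apply,
    Fintype.sum_prod_type]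
  refine Finset.sum_congr rfl fun q _ => Finset.sum_congr rfl fun b _ => ?_
  have hq : n - 1 - (n - 1 - (q : ℕ)) = q := by omega
  simp [hq]

namespace Loop

variable (S : Loop)

/-- The state after `k` periods of length `p` under the input sequence `w`. -/
def liftedTrajectory (p : ℕ) (x : Fin S.n → ℝ) (w : ℕ → Fin S.m → ℝ) : ℕ → Fin S.n → ℝ
  | 0 => x
  | k + 1 => S.liftedState p (liftedTrajectory p x w k) (w k)

variable {S}

lemma liftedTrajectory_eq (p : ℕ) (x : Fin S.n → ℝ) (w : ℕ → Fin S.m → ℝ) (k : ℕ) :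
    S.liftedTrajectory p x w k = S.liftA p ^ k *ᵥ x
      + ∑ q ∈ Finset.range k, (S.liftA p ^ q * S.liftB p) *ᵥ w (k - 1 - q) := by
  induction k with
  | zero => simp [liftedTrajectory]
  | succ k ih =>
    rw [liftedTrajectory, ih, liftedState, Finset.sum_range_succ', Matrix.mulVec_add,
      Matrix.mulVec_sum]
    have : ∀ q, k - 1 - q = k - (q + 1) := fun q => by omega
    simp only [Matrix.mulVec_mulVec, pow_succ', Matrix.mul_assoc, pow_zero, Matrix.one_mul, this,
      add_tsub_cancel_right, tsub_zero, add_assoc]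

/-- A controllable lifted loop can be steered to the origin in `n` periods. -/
lemma exists_liftedTrajectory_eq_zero {p : ℕ} (h : Controllable (S.liftA p) (S.liftB p))
    (x : Fin S.n → ℝ) : ∃ w, S.liftedTrajectory p x w S.n = 0 := by
  obtain ⟨w, hw⟩ := h.exists_sum_eq (-(S.liftA p ^ S.n *ᵥ x))
  exact ⟨w, by rw [liftedTrajectory_eq, hw, add_neg_cancel]⟩

/-! ### Value iteration and the Riccati equation. -/

section

variable {p : ℕ}

/-- The input optimal for `P'` is a candidate for `P`, and it ends with a smaller terminal cost. -/
lemma riccatiStep_mono (hQ : S.Q.PosDef) (hR : S.R.PosDef) (hp : 1 ≤ p)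
    {P P' : Matrix (Fin S.n) (Fin S.n) ℝ} (hP : P.PosSemidef) (hP' : P'.PosSemidef)
    (h : ∀ x, x ⬝ᵥ (P *ᵥ x) ≤ x ⬝ᵥ (P' *ᵥ x)) (x : Fin S.n → ℝ) :
    x ⬝ᵥ (S.riccatiStep p P *ᵥ x) ≤ x ⬝ᵥ (S.riccatiStep p P' *ᵥ x) := by
  rw [riccatiStep_eq hQ hR hp hP']
  exact (riccatiStep_le hQ hR hp hP x _).trans (add_le_add_right (h _) _)

lemma iterate_riccatiStep_posSemidef (hQ : S.Q.PosDef) (hR : S.R.PosDef) (hp : 1 ≤ p)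
    {P : Matrix (Fin S.n) (Fin S.n) ℝ} (hP : P.PosSemidef) (k : ℕ) :
    ((S.riccatiStep p)^[k] P).PosSemidef := by
  induction k with
  | zero => exact hP
  | succ k ih =>
    rw [Function.iterate_succ_apply']
    exact riccatiStep_posSemidef hQ hR hp ih

/-- The iterate is the optimal `k`-period cost with terminal weight `P`, hence at most the cost of
any particular input sequence. -/
lemma iterate_riccatiStep_le (hQ : S.Q.PosDef) (hR : S.R.PosDef) (hp : 1 ≤ p)
    (x : Fin S.n → ℝ) (w : ℕ → Fin S.m → ℝ) (k : ℕ)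
    {P : Matrix (Fin S.n) (Fin S.n) ℝ} (hP : P.PosSemidef) :
    x ⬝ᵥ ((S.riccatiStep p)^[k] P *ᵥ x) ≤
      ∑ j ∈ Finset.range k, S.liftedCost p (S.liftedTrajectory p x w j) (w j)
      + S.liftedTrajectory p x w k ⬝ᵥ (P *ᵥ S.liftedTrajectory p x w k) := by
  induction k generalizing P with
  | zero => simp [liftedTrajectory]
  | succ k ih =>
    rw [Function.iterate_succ_apply, Finset.sum_range_succ]
    have h1 := ih (riccatiStep_posSemidef hQ hR hp hP)
    have h2 := riccatiStep_le hQ hR hp hP (S.liftedTrajectory p x w k) (w k)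
    rw [liftedTrajectory]
    linarith

lemma iterate_riccatiStep_zero_mono (hQ : S.Q.PosDef) (hR : S.R.PosDef) (hp : 1 ≤ p)
    (x : Fin S.n → ℝ) : Monotone fun k => x ⬝ᵥ ((S.riccatiStep p)^[k] 0 *ᵥ x) := by
  refine monotone_nat_of_le_succ fun k => ?_
  induction k generalizing x with
  | zero =>
    simpa using (posSemidef_iff.1 (riccatiStep_posSemidef hQ hR hp Matrix.PosSemidef.zero)).2 x
  | succ k ih =>
    simp only [Function.iterate_succ_apply'] at ih ⊢
    have h := iterate_riccatiStep_posSemidef hQ hR hp (Matrix.PosSemidef.zero) k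
    exact riccatiStep_mono hQ hR hp h (riccatiStep_posSemidef hQ hR hp h) ih x

/-- For each fixed `x` the values are monotone and bounded by the cost of steering `x` to the
origin; polarization then gives convergence of the entries. -/
lemma exists_tendsto_iterate_riccatiStep (hQ : S.Q.PosDef) (hR : S.R.PosDef) (hp : 1 ≤ p)
    (hc : Controllable (S.liftA p) (S.liftB p)) :
    ∃ P, Filter.Tendsto (fun k => (S.riccatiStep p)^[k] 0) Filter.atTop (nhds P) := by
  have hlim : ∀ x, ∃ l, Filter.Tendsto (fun k => x ⬝ᵥ ((S.riccatiStep p)^[k] 0 *ᵥ x))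
      Filter.atTop (nhds l) := fun x => by
    have hm := iterate_riccatiStep_zero_mono hQ hR hp x
    refine ⟨_, tendsto_atTop_ciSup hm ?_⟩
    obtain ⟨w, hw⟩ := exists_liftedTrajectory_eq_zero hc x
    refine ⟨∑ j ∈ Finset.range S.n, S.liftedCost p (S.liftedTrajectory p x w j) (w j), ?_⟩
    rintro _ ⟨k, rfl⟩
    -- The iterate `k` is bounded by the iterate `S.n + k`: the first `S.n` periods reach the
    -- origin, where the remaining `k` cost nothing.
    refine (hm (Nat.le_add_left k S.n)).trans ?_
    have h := iterate_riccatiStep_le hQ hR hp x w S.n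
      (iterate_riccatiStep_posSemidef hQ hR hp Matrix.PosSemidef.zero k)
    simpa only [Function.iterate_add_apply, hw, zero_dotProduct, add_zero] using h
  choose l hl using hlim
  refine ⟨fun i j => (l (Pi.single i 1 + Pi.single j 1) - l (Pi.single i 1)
    - l (Pi.single j 1)) / 2, tendsto_pi_nhds.2 fun i => tendsto_pi_nhds.2 fun j => ?_⟩
  refine ((((hl _).sub (hl _)).sub (hl _)).div_const 2).congr fun k => ?_
  exact (polarization (posSemidef_iff.1
    (iterate_riccatiStep_posSemidef hQ hR hp Matrix.PosSemidef.zero k)).1 i j).symm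

lemma continuousAt_riccatiStep (hQ : S.Q.PosDef) (hR : S.R.PosDef) (hp : 1 ≤ p)
    {P : Matrix (Fin S.n) (Fin S.n) ℝ} (hP : P.PosSemidef) :
    ContinuousAt (S.riccatiStep p) P := by
  have hdet : IsUnit (S.liftR p + (S.liftB p)ᵀ * P * S.liftB p).det :=
    (Matrix.isUnit_iff_isUnit_det _).1 (weight_posDef hQ hR hp hP).isUnit
  have hG : Continuous fun P : Matrix (Fin S.n) (Fin S.n) ℝ =>
      S.liftR p + (S.liftB p)ᵀ * P * S.liftB p := by fun_prop
  have hH : Continuous fun P : Matrix (Fin S.n) (Fin S.n) ℝ =>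
      (S.liftA p)ᵀ * P * S.liftB p + S.liftN p := by fun_prop
  have hK : Continuous fun P : Matrix (Fin S.n) (Fin S.n) ℝ =>
      S.liftQ p + (S.liftA p)ᵀ * P * S.liftA p := by fun_prop
  have hmul : ∀ {a b c : ℕ} {f : Matrix (Fin S.n) (Fin S.n) ℝ → Matrix (Fin a) (Fin b) ℝ}
      {g : Matrix (Fin S.n) (Fin S.n) ℝ → Matrix (Fin b) (Fin c) ℝ},
      ContinuousAt f P → ContinuousAt g P → ContinuousAt (fun X => f X * g X) P :=
    fun {a b c f g} hf hg => (continuous_fst.matrix_mul continuous_snd :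
      Continuous fun X : Matrix (Fin a) (Fin b) ℝ × Matrix (Fin b) (Fin c) ℝ =>
        X.1 * X.2).continuousAt.comp (hf.prodMk hg)
  have hinv : ContinuousAt (fun P : Matrix (Fin S.n) (Fin S.n) ℝ =>
      (S.liftR p + (S.liftB p)ᵀ * P * S.liftB p)⁻¹) P := by
    refine ContinuousAt.comp (g := fun M : Matrix (Fin S.m) (Fin S.m) ℝ => M⁻¹)
      (continuousAt_matrix_inv _ ?_) hG.continuousAt
    -- Matrix inversion is continuous where inversion of the determinant is, that is, where the
    -- determinant is a unit.
    exact NormedRing.inverse_continuousAt hdet.unit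
  exact hK.continuousAt.sub
    (hmul hH.continuousAt (hmul hinv hH.matrix_transpose.continuousAt))

lemma exists_isRiccatiSolution (hQ : S.Q.PosDef) (hR : S.R.PosDef) (hp : 1 ≤ p)
    (hc : Controllable (S.liftA p) (S.liftB p)) : ∃ P, S.IsRiccatiSolution p P := by
  obtain ⟨P, hP⟩ := exists_tendsto_iterate_riccatiStep hQ hR hp hc
  have hpsd := iterate_riccatiStep_posSemidef hQ hR hp
    (Matrix.PosSemidef.zero (n := Fin S.n) (R := ℝ))
  have hPpsd : P.PosSemidef := by
    refine posSemidef_iff.2 ⟨?_, fun x => ?_⟩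
    · refine tendsto_nhds_unique ?_ hP
      refine ((continuous_id.matrix_transpose.tendsto P).comp hP).congr fun k => ?_
      exact (posSemidef_iff.1 (hpsd k)).1
    · have hcont : Continuous fun M : Matrix (Fin S.n) (Fin S.n) ℝ => x ⬝ᵥ (M *ᵥ x) := by
        fun_prop
      exact ge_of_tendsto' ((hcont.tendsto P).comp hP) fun k => (posSemidef_iff.1 (hpsd k)).2 x
  refine ⟨P, hPpsd, tendsto_nhds_unique (hP.comp (Filter.tendsto_add_atTop_nat 1)) ?_⟩
  refine ((continuousAt_riccatiStep hQ hR hp hPpsd).tendsto.comp hP).congr fun k => ?_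
  simp only [Function.comp, Function.iterate_succ_apply']

/-- The feedback trajectory generated by a Riccati solution, as an input sequence. -/
lemma IsRiccatiSolution.exists_optimal (hQ : S.Q.PosDef) (hR : S.R.PosDef) (hp : 1 ≤ p)
    {P : Matrix (Fin S.n) (Fin S.n) ℝ} (hP : S.IsRiccatiSolution p P) (x : Fin S.n → ℝ) :
    ∃ w, ∀ k, ∑ j ∈ Finset.range k, S.liftedCost p (S.liftedTrajectory p x w j) (w j)
      + S.liftedTrajectory p x w k ⬝ᵥ (P *ᵥ S.liftedTrajectory p x w k) = x ⬝ᵥ (P *ᵥ x) := by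
  let y : ℕ → Fin S.n → ℝ := fun k =>
    (fun z => S.liftedState p z (-(S.stepGain p P *ᵥ z)))^[k] x
  refine ⟨fun k => -(S.stepGain p P *ᵥ y k), ?_⟩
  have hy : ∀ k, S.liftedTrajectory p x (fun k => -(S.stepGain p P *ᵥ y k)) k = y k := by
    intro k
    induction k with
    | zero => rfl
    | succ k ih => simp only [liftedTrajectory, ih, y, Function.iterate_succ_apply']
  intro k
  simp only [hy]
  induction k with
  | zero => simp [y]
  | succ k ih =>
    have h := riccatiStep_eq hQ hR hp hP.1 (y k)
    rw [← hP.2] at h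
    rw [← ih, Finset.sum_range_succ, h]
    simp only [y, Function.iterate_succ_apply', add_assoc]

/-- The optimal inputs for `P` are a candidate for `P'`. The resulting bound exceeds the cost under
`P` by at most the terminal term of `P'`, which is controlled by a stage cost tending to `0`. -/
lemma IsRiccatiSolution.le (hQ : S.Q.PosDef) (hR : S.R.PosDef) (hp : 1 ≤ p)
    {P P' : Matrix (Fin S.n) (Fin S.n) ℝ} (hP : S.IsRiccatiSolution p P)
    (hP' : S.IsRiccatiSolution p P') (x : Fin S.n → ℝ) :
    x ⬝ᵥ (P' *ᵥ x) ≤ x ⬝ᵥ (P *ᵥ x) := by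
  obtain ⟨w, hw⟩ := hP.exists_optimal hQ hR hp x
  set y := S.liftedTrajectory p x w with hy
  have hsum : Summable fun j => S.liftedCost p (y j) (w j) :=
    summable_of_sum_range_le (c := x ⬝ᵥ (P *ᵥ x)) (fun j => liftedCost_nonneg hQ hR hp _ _)
      fun k => by linarith [hw k, (posSemidef_iff.1 hP.1).2 (y k)]
  obtain ⟨C, hC, hCle⟩ := exists_quadratic_le hQ P'
  have hle : ∀ k, x ⬝ᵥ (P' *ᵥ x) ≤ x ⬝ᵥ (P *ᵥ x) + C * S.liftedCost p (y k) (w k) := by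
    intro k
    have h1 := iterate_riccatiStep_le hQ hR hp x w k hP'.1
    rw [Function.iterate_fixed hP'.2.symm, ← hy] at h1
    have h2 := mul_le_mul_of_nonneg_left (le_liftedCost hQ hR hp (y k) (w k)) hC.le
    have h3 := mul_nonneg hC.le ((posSemidef_iff.1 hR.posSemidef).2 (w k))
    linarith [hw k, (posSemidef_iff.1 hP.1).2 (y k), hCle (y k)]
  have hlim := (hsum.tendsto_atTop_zero.const_mul C).const_add (x ⬝ᵥ (P *ᵥ x))
  rw [mul_zero, add_zero] at hlim
  exact ge_of_tendsto' hlim hle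

theorem existsUnique_isRiccatiSolution (hQ : S.Q.PosDef) (hR : S.R.PosDef) (hp : 1 ≤ p)
    (hc : Controllable (S.liftA p) (S.liftB p)) : ∃! P, S.IsRiccatiSolution p P := by
  obtain ⟨P, hP⟩ := exists_isRiccatiSolution hQ hR hp hc
  refine ⟨P, hP, fun P' hP' => ?_⟩
  exact eq_of_forall_quadratic_eq (posSemidef_iff.1 hP'.1).1 (posSemidef_iff.1 hP.1).1
    fun x => le_antisymm (hP.le hQ hR hp hP' x) (hP'.le hQ hR hp hP x)

lemma terminalP_isRiccatiSolution (hQ : S.Q.PosDef) (hR : S.R.PosDef) (hp : 1 ≤ p)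
    (hc : Controllable (S.liftA p) (S.liftB p)) : S.IsRiccatiSolution p (S.terminalP p) :=
  Classical.epsilon_spec (exists_isRiccatiSolution hQ hR hp hc)

end

/-! ### The closed loop and its contraction parameter. -/

section

variable {p i : ℕ}

lemma P_self (hT : S.IsRiccatiSolution p (S.terminalP p)) : S.P p p = S.terminalP p := hT.2.symm

lemma P_posSemidef (hQ : S.Q.PosDef) (hR : S.R.PosDef) (hi : 1 ≤ i)
    (hT : S.IsRiccatiSolution p (S.terminalP p)) : (S.P p i).PosSemidef := riccatiStep_posSemidef hQ hR hi hT.1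

lemma closedLoop_mulVec (x : Fin S.n → ℝ) :
    S.closedLoop p i *ᵥ x = S.liftedState i x (-(S.L p i *ᵥ x)) := by
  simp only [closedLoop, liftedState, Matrix.sub_mulVec, Matrix.mulVec_neg, Matrix.mulVec_mulVec,
    ← sub_eq_add_neg]

lemma quadratic_P_eq (hQ : S.Q.PosDef) (hR : S.R.PosDef) (hi : 1 ≤ i)
    (hT : S.IsRiccatiSolution p (S.terminalP p)) (x : Fin S.n → ℝ) :
    x ⬝ᵥ (S.P p i *ᵥ x) = S.liftedCost i x (-(S.L p i *ᵥ x)) +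
      (S.closedLoop p i *ᵥ x) ⬝ᵥ (S.P p p *ᵥ (S.closedLoop p i *ᵥ x)) := by
  rw [P_self hT, closedLoop_mulVec]
  exact riccatiStep_eq hQ hR hi hT.1 x

lemma quadratic_contraction (e : ℝ) (x : Fin S.n → ℝ) :
    x ⬝ᵥ (((1 - e) • S.P p i - (S.closedLoop p i)ᵀ * S.P p p * S.closedLoop p i) *ᵥ x) =
      (1 - e) * (x ⬝ᵥ (S.P p i *ᵥ x)) -
        (S.closedLoop p i *ᵥ x) ⬝ᵥ (S.P p p *ᵥ (S.closedLoop p i *ᵥ x)) := by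
  simp only [Matrix.sub_mulVec, Matrix.smul_mulVec, dotProduct_sub, dotProduct_smul, smul_eq_mul,
    ← Matrix.mulVec_mulVec, dotProduct_transpose_mulVec]

end

/-- Membership in the contraction set in terms of quadratic forms. -/
lemma mem_contractionSet_iff (hQ : S.Q.PosDef) (hR : S.R.PosDef) {p : ℕ} {I0 : Finset ℕ}
    (hp : p ∈ I0) (hI0 : ∀ i ∈ I0, 1 ≤ i) (hT : S.IsRiccatiSolution p (S.terminalP p)) {e : ℝ} :
    e ∈ S.contractionSet p I0 ↔ 0 < e ∧ e ≤ 1 ∧ ∀ i ∈ I0, ∀ x,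
      (S.closedLoop p i *ᵥ x) ⬝ᵥ (S.P p p *ᵥ (S.closedLoop p i *ᵥ x)) ≤
        (1 - e) * (x ⬝ᵥ (S.P p i *ᵥ x)) := by
  refine and_congr_right fun _ => and_congr_right fun _ => forall₂_congr fun i hi => ?_
  have hsymm : ((1 - e) • S.P p i
      - (S.closedLoop p i)ᵀ * S.P p p * S.closedLoop p i).IsSymm :=
    ((posSemidef_iff.1 (P_posSemidef hQ hR (hI0 i hi) hT)).1.smul _).sub
      (isSymm_transpose_mul_mul (posSemidef_iff.1 (P_posSemidef hQ hR (hI0 p hp) hT)).1 _)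
  simp only [posSemidef_iff, hsymm, true_and, quadratic_contraction, sub_nonneg]

lemma exists_isGreatest_contractionSet (hQ : S.Q.PosDef) (hR : S.R.PosDef) {p : ℕ}
    {I0 : Finset ℕ} (hp : p ∈ I0) (hI0 : ∀ i ∈ I0, 1 ≤ i)
    (hT : S.IsRiccatiSolution p (S.terminalP p)) :
    ∃ ε, IsGreatest (S.contractionSet p I0) ε := by
  have hne : (S.contractionSet p I0).Nonempty := by
    choose C hC hCle using fun i => exists_quadratic_le hQ (S.P p i)
    have hD : 0 ≤ ∑ i ∈ I0, C i := Finset.sum_nonneg fun i _ => (hC i).le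
    -- This fraction of `P^{(i)}` is below `Q`, hence below the cost of the hold, which is exactly
    -- what `P^{(i)}` loses in `quadratic_P_eq`. The summand `1` keeps the parameter at most `1`.
    refine ⟨1 / (1 + ∑ i ∈ I0, C i), (mem_contractionSet_iff hQ hR hp hI0 hT).2
      ⟨by positivity, ?_, fun i hi x => ?_⟩⟩
    · rw [div_le_one (by positivity)]
      linarith
    have hq := (posSemidef_iff.1 hQ.posSemidef).2 x
    have h1 : C i ≤ 1 + ∑ i ∈ I0, C i := by
      linarith [Finset.single_le_sum (fun i _ => (hC i).le) hi]
    have h2 : 1 / (1 + ∑ i ∈ I0, C i) * (x ⬝ᵥ (S.P p i *ᵥ x)) ≤ x ⬝ᵥ (S.Q *ᵥ x) := by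
      rw [one_div_mul_eq_div, div_le_iff₀ (by positivity), mul_comm]
      exact (hCle i x).trans (mul_le_mul_of_nonneg_right h1 hq)
    have h3 := le_liftedCost hQ hR (hI0 i hi) x (-(S.L p i *ᵥ x))
    have h4 := (posSemidef_iff.1 hR.posSemidef).2 (-(S.L p i *ᵥ x))
    have h5 := quadratic_P_eq hQ hR (hI0 i hi) hT x
    linarith
  have hbdd : BddAbove (S.contractionSet p I0) := ⟨1, fun e he => he.2.1⟩
  refine ⟨sSup (S.contractionSet p I0), (mem_contractionSet_iff hQ hR hp hI0 hT).2
    ⟨?_, ?_, fun i hi x => ?_⟩, fun e he => le_csSup hbdd he⟩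
  · obtain ⟨e, he⟩ := hne
    exact he.1.trans_le (le_csSup hbdd he)
  · exact csSup_le hne fun e he => he.2.1
  -- For fixed `i` and `x` the inequality is closed in the parameter, so it passes to the supremum.
  · obtain ⟨u, -, hu, hmem⟩ := exists_seq_tendsto_sSup hne hbdd
    refine ge_of_tendsto' ((hu.const_sub 1).mul_const _) fun k => ?_
    exact ((mem_contractionSet_iff hQ hR hp hI0 hT).1 (hmem k)).2.2 i hi x

end Loop

end SelfTriggered

end

/-! ### Minimal costs and feasible waiting times. -/

noncomputable section

namespace SelfTriggered

namespace Loop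

variable {S : Loop} {p : ℕ} {x : Fin S.n → ℝ} {F : Finset ℕ}

lemma mem_minimizers {i : ℕ} :
    i ∈ S.minimizers p x F ↔ i ∈ F ∧ ∀ j ∈ F, S.cost p x i ≤ S.cost p x j := by
  simp [minimizers]

lemma minimizers_nonempty (hF : F.Nonempty) : (S.minimizers p x F).Nonempty := by
  obtain ⟨i, hi, h⟩ := F.exists_min_image (S.cost p x) hF
  exact ⟨i, mem_minimizers.2 ⟨hi, h⟩⟩

lemma minCost_eq {i : ℕ} (hi : i ∈ S.minimizers p x F) : S.minCost p x F = S.cost p x i := by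
  rw [mem_minimizers] at hi
  refine IsLeast.csInf_eq ⟨⟨i, hi.1, rfl⟩, ?_⟩
  rintro _ ⟨j, hj, rfl⟩
  exact hi.2 j hj

lemma minCost_le {j : ℕ} (hj : j ∈ F) : S.minCost p x F ≤ S.cost p x j := by
  obtain ⟨i, hi⟩ := minimizers_nonempty (S := S) (p := p) (x := x) ⟨j, hj⟩
  rw [minCost_eq hi]
  exact (mem_minimizers.1 hi).2 j hj

end Loop

section Schedule

variable {s : ℕ} {I0 : Finset ℕ} {p : ℕ}

/-- Among `1, …, s` some residue modulo `p ≥ s` avoids the at most `s - 1` residues of the other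
loops. -/
lemma exists_avoiding (hsp : s ≤ p) (ℓ : Fin s) (f : Fin s → ℤ) :
    ∃ i, 1 ≤ i ∧ i ≤ s ∧ ∀ q, q ≠ ℓ → ∀ r : ℤ, (i : ℤ) ≠ f q + r * p := by
  have : Nonempty (Fin s) := ⟨ℓ⟩
  by_contra! h
  choose! g hg r hr using h
  -- Pigeonhole: if each of the `s` candidates were blocked by one of the `s - 1` other loops, two
  -- would be blocked by the same loop and so be congruent modulo `p`, although they differ by less
  -- than `s ≤ p`.
  have hcard : (Finset.univ.erase ℓ).card < (Finset.Icc 1 s).card := by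
    have : 0 < s := ℓ.pos
    simp
    omega
  obtain ⟨i, hi, j, hj, hij, hgij⟩ := Finset.exists_ne_map_eq_of_card_lt_of_maps_to hcard
    (f := g) fun i hi => by
      rw [Finset.coe_Icc, Set.mem_Icc] at hi
      simpa using hg i hi.1 hi.2
  rw [Finset.mem_Icc] at hi hj
  have hi' := hr i hi.1 hi.2
  have hj' := hr j hj.1 hj.2
  rw [hgij] at hi'
  have hdvd : (p : ℤ) ∣ (i : ℤ) - j := ⟨r i - r j, by rw [hi', hj']; ring⟩
  have := Int.eq_zero_of_abs_lt_dvd hdvd (by rw [abs_lt]; constructor <;> omega)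
  omega

lemma mem_feasible_zero {next : Fin s → ℕ → ℕ} {ℓ : Fin s} {i : ℕ} :
    i ∈ feasible I0 p next ℓ 0 ↔
      i ∈ I0 ∧ ∀ q, q < ℓ → ∀ r : ℤ, (i : ℤ) ≠ (next q 0 : ℤ) - 0 + r * p := by
  simp only [feasible, Finset.mem_filter]

lemma mem_feasible_succ {next : Fin s → ℕ → ℕ} {ℓ : Fin s} {k i : ℕ} :
    i ∈ feasible I0 p next ℓ (k + 1) ↔
      i ∈ I0 ∧ ∀ q, q ≠ ℓ → ∀ r : ℤ,
        (i : ℤ) ≠ (next q k : ℤ) - ((k + 1 : ℕ) : ℤ) + r * p := by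
  simp only [feasible, Finset.mem_filter]

lemma feasible_subset (next : Fin s → ℕ → ℕ) (ℓ : Fin s) (k : ℕ) :
    feasible I0 p next ℓ k ⊆ I0 := by
  intro i hi
  cases k with
  | zero => exact (mem_feasible_zero.1 hi).1
  | succ k => exact (mem_feasible_succ.1 hi).1

lemma feasible_nonempty (hL : ∀ i, 1 ≤ i → i ≤ s → i ∈ I0) (hsp : s ≤ p)
    (next : Fin s → ℕ → ℕ) (ℓ : Fin s) (k : ℕ) : (feasible I0 p next ℓ k).Nonempty := by
  cases k with
  | zero =>
    obtain ⟨i, h1, hs, h⟩ := exists_avoiding hsp ℓ fun q => (next q 0 : ℤ) - 0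
    exact ⟨i, mem_feasible_zero.2 ⟨hL i h1 hs, fun q hq => h q hq.ne⟩⟩
  | succ k =>
    obtain ⟨i, h1, hs, h⟩ := exists_avoiding hsp ℓ
      fun q => (next q k : ℤ) - ((k + 1 : ℕ) : ℤ)
    exact ⟨i, mem_feasible_succ.2 ⟨hL i h1 hs, h⟩⟩

end Schedule

/-! ### Properties of an arbitrary run. -/

namespace IsRun

variable {s : ℕ} {loop : Fin s → Loop} {I0 : Finset ℕ} {p : ℕ}
  {x : ∀ ℓ, ℕ → Fin (loop ℓ).n → ℝ} {u : ∀ ℓ, ℕ → Fin (loop ℓ).m → ℝ} {next : Fin s → ℕ → ℕ}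

lemma lt_next (h : IsRun loop I0 p x u next) (hI0 : ∀ i ∈ I0, 1 ≤ i) (ℓ : Fin s) (k : ℕ) :
    k < next ℓ k := by
  have hsample : ∀ k, IsSampled next ℓ k → k < next ℓ k := fun k hk => by
    obtain ⟨i, hi, hn, -⟩ := h.sample ℓ k hk
    have := hI0 i (feasible_subset _ _ _ (Loop.mem_minimizers.1 hi).1)
    omega
  induction k with
  | zero => exact hsample 0 trivial
  | succ k ih =>
    by_cases hk : IsSampled next ℓ (k + 1)
    · exact hsample _ hk
    · rw [(h.hold ℓ k hk).1]
      exact lt_of_le_of_ne ih fun e => hk e.symm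

/-- The scheduled times of different loops are distinct modulo the period. -/
lemma next_ne (h : IsRun loop I0 p x u next) (k : ℕ) {ℓ q : Fin s} (hq : q ≠ ℓ) (r : ℤ) :
    (next ℓ k : ℤ) ≠ next q k + r * p := by
  induction k generalizing ℓ q r with
  | zero =>
    have key : ∀ {ℓ q : Fin s}, q < ℓ → ∀ r : ℤ, (next ℓ 0 : ℤ) ≠ next q 0 + r * p := by
      intro ℓ q hlt r
      obtain ⟨i, hi, hn, -⟩ := h.sample ℓ 0 trivial
      have := (mem_feasible_zero.1 (Loop.mem_minimizers.1 hi).1).2 q hlt r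
      rw [hn]
      simpa using this
    rcases lt_or_gt_of_ne hq with hlt | hlt
    · exact key hlt r
    · intro e
      exact key hlt (-r) (by rw [e]; ring)
  | succ k ih =>
    have key : ∀ {ℓ q : Fin s}, q ≠ ℓ → IsSampled next ℓ (k + 1) →
        ¬ IsSampled next q (k + 1) → ∀ r : ℤ, (next ℓ (k + 1) : ℤ) ≠ next q (k + 1) + r * p := by
      intro ℓ q hne hℓ hq r e
      obtain ⟨i, hi, hn, -⟩ := h.sample ℓ (k + 1) hℓ
      rw [(h.hold q k hq).1, hn] at e
      refine (mem_feasible_succ.1 (Loop.mem_minimizers.1 hi).1).2 q hne r ?_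
      push_cast at e ⊢
      linarith
    by_cases hℓ : IsSampled next ℓ (k + 1) <;> by_cases hq' : IsSampled next q (k + 1)
    -- Simultaneous sampling would mean equal pending times, which the induction hypothesis with `r
    -- = 0` excludes.
    · refine absurd ?_ (ih hq 0)
      have h1 : next ℓ k = k + 1 := hℓ
      have h2 : next q k = k + 1 := hq'
      simp [h1, h2]
    · exact key hq hℓ hq' r
    · intro e
      exact key hq.symm hq' hℓ (-r) (by rw [e]; ring)
    · rw [(h.hold ℓ k hℓ).1, (h.hold q k hq').1]
      exact ih hq r

lemma hold_of_lt_next (h : IsRun loop I0 p x u next) (ℓ : Fin s) {k j : ℕ} (hkj : k ≤ j)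
    (hj : j < next ℓ k) : next ℓ j = next ℓ k ∧ u ℓ j = u ℓ k := by
  induction j, hkj using Nat.le_induction with
  | base => exact ⟨rfl, rfl⟩
  | succ j _ ih =>
    obtain ⟨h1, h2⟩ := ih (by omega)
    have hns : ¬ IsSampled next ℓ (j + 1) := fun hs => by
      have : next ℓ j = j + 1 := hs
      omega
    rw [(h.hold ℓ j hns).1, (h.hold ℓ j hns).2]
    exact ⟨h1, h2⟩

lemma isSampled_next (h : IsRun loop I0 p x u next) (hI0 : ∀ i ∈ I0, 1 ≤ i) (ℓ : Fin s) (k : ℕ) :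
    IsSampled next ℓ (next ℓ k) := by
  have hlt := h.lt_next hI0 ℓ k
  obtain ⟨j, hj⟩ : ∃ j, next ℓ k = j + 1 := ⟨next ℓ k - 1, by omega⟩
  rw [hj]
  change next ℓ j = j + 1
  rw [(h.hold_of_lt_next ℓ (by omega : k ≤ j) (by omega)).1, hj]

lemma frequently_isSampled (h : IsRun loop I0 p x u next) (hI0 : ∀ i ∈ I0, 1 ≤ i) (ℓ : Fin s) :
    ∃ᶠ k in Filter.atTop, IsSampled next ℓ k :=
  Filter.frequently_atTop.2 fun k =>
    ⟨next ℓ k, (h.lt_next hI0 ℓ k).le, h.isSampled_next hI0 ℓ k⟩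

/-- The schedule in force at time `k` was fixed at some sampling instant. -/
lemma exists_isSampled_le (h : IsRun loop I0 p x u next) (ℓ : Fin s) (k : ℕ) :
    ∃ j ≤ k, IsSampled next ℓ j ∧ next ℓ j = next ℓ k := by
  induction k with
  | zero => exact ⟨0, le_rfl, trivial, rfl⟩
  | succ k ih =>
    by_cases hk : IsSampled next ℓ (k + 1)
    · exact ⟨k + 1, le_rfl, hk, rfl⟩
    · obtain ⟨j, hj, hs, hn⟩ := ih
      exact ⟨j, by omega, hs, by rw [hn, (h.hold ℓ k hk).1]⟩

/-- Every sampling instant after time `0` has a preceding one. -/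
lemma exists_next_eq (h : IsRun loop I0 p x u next) (ℓ : Fin s) {k : ℕ} (hk : 0 < k)
    (hs : IsSampled next ℓ k) : ∃ j < k, IsSampled next ℓ j ∧ next ℓ j = k := by
  obtain ⟨k, rfl⟩ : ∃ k', k = k' + 1 := ⟨k - 1, by omega⟩
  obtain ⟨j, hj, hjs, hn⟩ := h.exists_isSampled_le ℓ k
  exact ⟨j, by omega, hjs, hn.trans hs⟩

lemma state_eq (h : IsRun loop I0 p x u next) (ℓ : Fin s) (k i : ℕ) (hi : k + i ≤ next ℓ k) :
    x ℓ (k + i) = (loop ℓ).liftedState i (x ℓ k) (u ℓ k) := by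
  induction i with
  | zero => rw [Loop.liftedState_zero, add_zero]
  | succ i ih =>
    rw [← add_assoc, h.dynamics, ih (by omega), Loop.liftedState_succ,
      (h.hold_of_lt_next ℓ (by omega : k ≤ k + i) (by omega)).2]

/-- The period is a feasible waiting time at every sampling instant after time `0`. -/
lemma period_mem_feasible (h : IsRun loop I0 p x u next) (hp : p ∈ I0) (ℓ : Fin s) {k : ℕ}
    (hk : 0 < k) (hs : IsSampled next ℓ k) : p ∈ feasible I0 p next ℓ k := by
  obtain ⟨k, rfl⟩ : ∃ k', k = k' + 1 := ⟨k - 1, by omega⟩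
  -- The current time is the loop's own pending time, so a conflict for waiting time `p` would be a
  -- congruence between two pending times, with multiplier `r - 1`.
  refine mem_feasible_succ.2 ⟨hp, fun q hq r e => h.next_ne k hq (r - 1) ?_⟩
  have hs' : next ℓ k = k + 1 := hs
  rw [hs', sub_mul, one_mul]
  linarith

/-- The optimal cost contracts, up to a constant, from one sampling instant to the next. -/
lemma minCost_next_le (h : IsRun loop I0 p x u next) (hp : p ∈ I0) (hI0 : ∀ i ∈ I0, 1 ≤ i)
    {γ : ℕ} (hγ : ∀ i ∈ I0, i ≤ γ) {ℓ : Fin s} (hα : 0 ≤ (loop ℓ).α)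
    (hQ : (loop ℓ).Q.PosDef) (hR : (loop ℓ).R.PosDef)
    (hT : (loop ℓ).IsRiccatiSolution p ((loop ℓ).terminalP p)) {ε : ℝ}
    (hε : ε ∈ (loop ℓ).contractionSet p I0) {k : ℕ} (hs : IsSampled next ℓ k) :
    (loop ℓ).minCost p (x ℓ (next ℓ k)) (feasible I0 p next ℓ (next ℓ k)) ≤
      (loop ℓ).α / p + (1 - ε) *
        ((loop ℓ).minCost p (x ℓ k) (feasible I0 p next ℓ k) - (loop ℓ).α / γ) := by
  obtain ⟨-, hε1, hcontr⟩ := (Loop.mem_contractionSet_iff hQ hR hp hI0 hT).1 hε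
  obtain ⟨i, hi, hn, hu⟩ := h.sample ℓ k hs
  have hiI0 := feasible_subset _ _ _ (Loop.mem_minimizers.1 hi).1
  have hx : x ℓ (next ℓ k) = (loop ℓ).closedLoop p i *ᵥ x ℓ k := by
    rw [hn, h.state_eq ℓ k i hn.ge, hu, Loop.closedLoop_mulVec]
  have hfeas := h.period_mem_feasible hp ℓ ((Nat.zero_le k).trans_lt (h.lt_next hI0 ℓ k))
    (h.isSampled_next hI0 ℓ k)
  refine (Loop.minCost_le hfeas).trans ?_
  rw [Loop.minCost_eq hi, hx, Loop.cost, Loop.cost]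
  have hdiv : (loop ℓ).α / γ ≤ (loop ℓ).α / i :=
    div_le_div_of_nonneg_left hα (by exact_mod_cast hI0 i hiI0) (by exact_mod_cast hγ i hiI0)
  have h1 := hcontr i hiI0 (x ℓ k)
  have h2 := mul_le_mul_of_nonneg_left hdiv (sub_nonneg.2 hε1)
  linarith

lemma le_minCost (h : IsRun loop I0 p x u next) (hI0 : ∀ i ∈ I0, 1 ≤ i)
    {γ : ℕ} (hγ : ∀ i ∈ I0, i ≤ γ) {ℓ : Fin s} (hα : 0 ≤ (loop ℓ).α)
    (hQ : (loop ℓ).Q.PosDef) (hR : (loop ℓ).R.PosDef)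
    (hT : (loop ℓ).IsRiccatiSolution p ((loop ℓ).terminalP p)) {k : ℕ}
    (hs : IsSampled next ℓ k) :
    (loop ℓ).α / γ ≤ (loop ℓ).minCost p (x ℓ k) (feasible I0 p next ℓ k) := by
  obtain ⟨i, hi, -, -⟩ := h.sample ℓ k hs
  have hiI0 := feasible_subset _ _ _ (Loop.mem_minimizers.1 hi).1
  have hdiv : (loop ℓ).α / γ ≤ (loop ℓ).α / i :=
    div_le_div_of_nonneg_left hα (by exact_mod_cast hI0 i hiI0) (by exact_mod_cast hγ i hiI0)
  rw [Loop.minCost_eq hi, Loop.cost]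
  linarith [(posSemidef_iff.1 (Loop.P_posSemidef hQ hR (hI0 i hiI0) hT)).2 (x ℓ k)]

/-- A quantity contracting towards `0` between consecutive sampling instants is eventually at most
`δ` at the sampling instants. -/
lemma eventually_le_of_contraction (h : IsRun loop I0 p x u next) (hI0 : ∀ i ∈ I0, 1 ≤ i)
    (ℓ : Fin s) {D : ℕ → ℝ} {c : ℝ} (hc0 : 0 ≤ c) (hc1 : c < 1)
    (hD : ∀ k, IsSampled next ℓ k → D (next ℓ k) ≤ c * D k) {δ : ℝ} (hδ : 0 < δ) :
    ∀ᶠ k in Filter.atTop, IsSampled next ℓ k → D k ≤ δ := by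
  -- One factor `c` is gained per sampling interval. The absolute value is needed because `D` may be
  -- negative.
  have hpow : ∀ N : ℕ, ∃ K, ∀ k ≥ K, IsSampled next ℓ k → D k ≤ c ^ N * |D 0| := by
    intro N
    induction N with
    | zero =>
      refine ⟨0, fun k _ => ?_⟩
      induction k using Nat.strong_induction_on with
      | _ k ih =>
        intro hs
        rcases Nat.eq_zero_or_pos k with rfl | hk
        · simpa using le_abs_self (D 0)
        · obtain ⟨j, hj, hjs, hn⟩ := h.exists_next_eq ℓ hk hs
          have h1 := hD j hjs
          have h2 := ih j hj (Nat.zero_le _) hjs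
          rw [hn] at h1
          rw [pow_zero, one_mul] at h2 ⊢
          nlinarith [abs_nonneg (D 0), mul_le_mul_of_nonneg_left h2 hc0]
    | succ N ih =>
      obtain ⟨K, hK⟩ := ih
      -- Beyond `next ℓ K` the preceding sampling instant is at least `K`: an earlier one would
      -- still be in force at `K`, forcing `next ℓ K = k`.
      refine ⟨next ℓ K + 1, fun k hk hs => ?_⟩
      obtain ⟨j, hj, hjs, hn⟩ := h.exists_next_eq ℓ (by omega) hs
      have hjK : K ≤ j := by
        by_contra! hlt
        have := h.lt_next hI0 ℓ K
        have := (h.hold_of_lt_next ℓ hlt.le (by omega)).1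
        omega
      have h1 := hD j hjs
      rw [hn] at h1
      rw [pow_succ', mul_assoc]
      exact h1.trans (mul_le_mul_of_nonneg_left (hK j hjK hjs) hc0)
  have hlim := (tendsto_pow_atTop_nhds_zero_of_lt_one hc0 hc1).mul_const |D 0|
  rw [zero_mul] at hlim
  obtain ⟨N, hN⟩ := (hlim.eventually_le_const hδ).exists
  obtain ⟨K, hK⟩ := hpow N
  filter_upwards [Filter.eventually_ge_atTop K] with k hk hs
  exact (hK k hk hs).trans hN

lemma eventually_minCost_le (h : IsRun loop I0 p x u next) (hp : p ∈ I0)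
    (hI0 : ∀ i ∈ I0, 1 ≤ i) {γ : ℕ} (hγ : ∀ i ∈ I0, i ≤ γ) {ℓ : Fin s} (hα : 0 ≤ (loop ℓ).α)
    (hQ : (loop ℓ).Q.PosDef) (hR : (loop ℓ).R.PosDef)
    (hT : (loop ℓ).IsRiccatiSolution p ((loop ℓ).terminalP p)) {ε : ℝ}
    (hε : ε ∈ (loop ℓ).contractionSet p I0) {δ : ℝ} (hδ : 0 < δ) :
    ∀ᶠ k in Filter.atTop, IsSampled next ℓ k →
      (loop ℓ).minCost p (x ℓ k) (feasible I0 p next ℓ k) ≤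
        (loop ℓ).α / ε * (1 / p - (1 - ε) * (1 / γ)) + δ := by
  have hε0 : ε ≠ 0 := hε.1.ne'
  set W : ℝ := (loop ℓ).α / ε * (1 / p - (1 - ε) * (1 / γ)) with hW
  -- `W` is the fixed point of the affine recursion in `minCost_next_le`, so `minCost - W` contracts
  -- with factor `1 - ε`.
  have hfix : (loop ℓ).α / p - (1 - ε) * ((loop ℓ).α / γ) = W - (1 - ε) * W := by
    have h1 : W - (1 - ε) * W = (loop ℓ).α * (ε / ε) * (1 / p - (1 - ε) * (1 / γ)) := by
      rw [hW]; ring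
    rw [h1, div_self hε0]
    ring
  have hev := h.eventually_le_of_contraction hI0 ℓ
    (D := fun k => (loop ℓ).minCost p (x ℓ k) (feasible I0 p next ℓ k) - W)
    (sub_nonneg.2 hε.2.1) (sub_lt_self 1 hε.1)
    (fun k hs => by
      have := h.minCost_next_le hp hI0 hγ hα hQ hR hT hε hs
      linarith) hδ
  filter_upwards [hev] with k hk hs
  linarith [hk hs]

end IsRun

/-! ### Construction of a run. -/

section Existence

variable {s : ℕ} (loop : Fin s → Loop) (I0 : Finset ℕ) (p : ℕ)
  (tie : Fin s → ℕ → Finset ℕ → ℕ)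

/-- The waiting time chosen by loop `ℓ` at time `k` in state `z` under the schedule `next`. -/
def waitingTime (next : Fin s → ℕ → ℕ) (ℓ : Fin s) (k : ℕ) (z : Fin (loop ℓ).n → ℝ) : ℕ :=
  tie ℓ k ((loop ℓ).minimizers p z (feasible I0 p next ℓ k))

/-- The schedule fixed at time `0`, where the loops are processed in increasing order. -/
def initialNext (x₀ : ∀ ℓ, Fin (loop ℓ).n → ℝ) : Fin s → ℕ :=
  wellFounded_lt.fix fun ℓ prev =>
    waitingTime loop I0 p tie (fun q _ => if h : q < ℓ then prev q h else 0) ℓ 0 (x₀ ℓ)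

lemma initialNext_eq (x₀ : ∀ ℓ, Fin (loop ℓ).n → ℝ) (ℓ : Fin s) :
    initialNext loop I0 p tie x₀ ℓ =
      waitingTime loop I0 p tie (fun q _ => initialNext loop I0 p tie x₀ q) ℓ 0 (x₀ ℓ) := by
  conv_lhs => rw [initialNext, wellFounded_lt.fix_eq]
  -- The default `0` for loops not yet processed is harmless: feasibility at time `0` reads only the
  -- loops `q < ℓ`.
  have : feasible I0 p (fun q _ => if q < ℓ then initialNext loop I0 p tie x₀ q else 0) ℓ 0 =
      feasible I0 p (fun q _ => initialNext loop I0 p tie x₀ q) ℓ 0 := by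
    ext i
    simp only [mem_feasible_zero]
    refine and_congr_right fun _ => forall₂_congr fun q hq => ?_
    rw [if_pos hq]
  exact congrArg (fun F => tie ℓ 0 ((loop ℓ).minimizers p (x₀ ℓ) F)) this

/-- State, input and scheduled sampling time of every loop, as generated by the algorithm. -/
def runState (x₀ : ∀ ℓ, Fin (loop ℓ).n → ℝ) :
    ℕ → ∀ ℓ, (Fin (loop ℓ).n → ℝ) × (Fin (loop ℓ).m → ℝ) × ℕ
  | 0 => fun ℓ => (x₀ ℓ, -((loop ℓ).L p (initialNext loop I0 p tie x₀ ℓ) *ᵥ x₀ ℓ),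
      initialNext loop I0 p tie x₀ ℓ)
  | k + 1 => fun ℓ =>
      let z := (loop ℓ).A *ᵥ (runState x₀ k ℓ).1 + (loop ℓ).B *ᵥ (runState x₀ k ℓ).2.1
      -- A schedule constant in time suffices, since feasibility at `k + 1` reads only the schedule
      -- left at time `k`.
      let i := waitingTime loop I0 p tie (fun q _ => (runState x₀ k q).2.2) ℓ (k + 1) z
      if (runState x₀ k ℓ).2.2 = k + 1 then (z, -((loop ℓ).L p i *ᵥ z), k + 1 + i)
      else (z, (runState x₀ k ℓ).2)

variable {loop I0 p tie}

/-- The recursion is total for any `tie`; nonemptiness of the feasible sets makes each selected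
waiting time a genuine minimizer. -/
theorem exists_isRun (hL : ∀ i, 1 ≤ i → i ≤ s → i ∈ I0) (hsp : s ≤ p)
    (htie : ∀ ℓ k (F : Finset ℕ), F.Nonempty → tie ℓ k F ∈ F)
    (x₀ : ∀ ℓ, Fin (loop ℓ).n → ℝ) :
    ∃ x u next, IsRun loop I0 p x u next ∧ (∀ ℓ, x ℓ 0 = x₀ ℓ) ∧
      ∀ ℓ k, IsSampled next ℓ k →
        next ℓ k = k + tie ℓ k ((loop ℓ).minimizers p (x ℓ k) (feasible I0 p next ℓ k)) := by
  set σ := runState loop I0 p tie x₀ with hσ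
  have hx : ∀ ℓ k, (σ (k + 1) ℓ).1 = (loop ℓ).A *ᵥ (σ k ℓ).1 + (loop ℓ).B *ᵥ (σ k ℓ).2.1 := by
    intro ℓ k
    rw [hσ, runState]
    dsimp only
    split_ifs <;> rfl
  have hsample : ∀ ℓ k, IsSampled (fun ℓ k => (σ k ℓ).2.2) ℓ k →
      (σ k ℓ).2.2 = k + waitingTime loop I0 p tie (fun ℓ k => (σ k ℓ).2.2) ℓ k (σ k ℓ).1 ∧
      (σ k ℓ).2.1 = -((loop ℓ).L p (waitingTime loop I0 p tie (fun ℓ k => (σ k ℓ).2.2) ℓ k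
        (σ k ℓ).1) *ᵥ (σ k ℓ).1) := by
    intro ℓ k hk
    cases k with
    | zero =>
      have h0 := initialNext_eq loop I0 p tie x₀ ℓ
      refine ⟨(h0.trans (Nat.zero_add _).symm), ?_⟩
      exact congrArg (fun i => -((loop ℓ).L p i *ᵥ x₀ ℓ)) h0
    | succ k =>
      have hk' : (σ k ℓ).2.2 = k + 1 := hk
      have hstep : σ (k + 1) ℓ = _ := if_pos hk'
      rw [hstep]
      exact ⟨rfl, rfl⟩
  refine ⟨fun ℓ k => (σ k ℓ).1, fun ℓ k => (σ k ℓ).2.1, fun ℓ k => (σ k ℓ).2.2,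
    ⟨hx, fun ℓ k hk => ?_, fun ℓ k hk => ?_⟩, fun ℓ => rfl, fun ℓ k hk => (hsample ℓ k hk).1⟩
  · exact ⟨_, htie ℓ k _ (Loop.minimizers_nonempty (feasible_nonempty hL hsp _ ℓ k)),
      hsample ℓ k hk⟩
  · have hstep : σ (k + 1) ℓ = _ := if_neg hk
    rw [hstep]
    exact ⟨rfl, rfl⟩

end Existence

end SelfTriggered

end

theorem theorem4 {s : ℕ} (hs : 1 ≤ s) (loop : Fin s → SelfTriggered.Loop)
    (I0 : Finset ℕ) (γ pstar : ℕ)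
    (hα : ∀ ℓ, 0 ≤ (loop ℓ).α)
    (hQ : ∀ ℓ, (loop ℓ).Q.PosDef)
    (hR : ∀ ℓ, (loop ℓ).R.PosDef)
    (hctrl : ∀ ℓ, SelfTriggered.Controllable (loop ℓ).A (loop ℓ).B)
    (hI0 : ∀ i ∈ I0, 1 ≤ i)
    (hγ : IsGreatest (I0 : Set ℕ) γ)
    -- the common period is the largest waiting time avoiding nontrivial roots of unity
    (hp : IsGreatest {i : ℕ | i ∈ I0 ∧ ∀ ℓ,
      ∀ z ∈ spectrum ℂ ((loop ℓ).A.map (algebraMap ℝ ℂ)), z ≠ 1 → z ^ i ≠ 1} pstar)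
    -- the scheduling assumption: `{1, …, s} ⊆ I0` and `s ≤ p`
    (hL : ∀ i, 1 ≤ i → i ≤ s → i ∈ I0)
    (hsp : s ≤ pstar)
    -- the down-sampled pairs are controllable
    (hdown : ∀ ℓ, SelfTriggered.Controllable ((loop ℓ).liftA pstar) ((loop ℓ).liftB pstar)) :
    -- the Riccati equations determine the matrices that the controller uses
    (∀ ℓ, ∃! P, (loop ℓ).IsRiccatiSolution pstar P) ∧
    -- the algorithm can be run from every initial state, whatever the tie-breaking rule
    (∀ tie : Fin s → ℕ → Finset ℕ → ℕ,
      (∀ ℓ k (F : Finset ℕ), F.Nonempty → tie ℓ k F ∈ F) →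
      ∀ x₀ : ∀ ℓ, Fin (loop ℓ).n → ℝ, ∃ x u next,
        SelfTriggered.IsRun loop I0 pstar x u next ∧ (∀ ℓ, x ℓ 0 = x₀ ℓ) ∧
        ∀ ℓ k, SelfTriggered.IsSampled next ℓ k →
          next ℓ k = k + tie ℓ k ((loop ℓ).minimizers pstar (x ℓ k)
            (SelfTriggered.feasible I0 pstar next ℓ k))) ∧
    -- the bounds
    ∀ ℓ, ∃ ε, IsGreatest ((loop ℓ).contractionSet pstar I0) ε ∧
      ∀ x u next, SelfTriggered.IsRun loop I0 pstar x u next →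
        (∃ᶠ k in Filter.atTop, SelfTriggered.IsSampled next ℓ k) ∧
        (∀ k, SelfTriggered.IsSampled next ℓ k →
          (SelfTriggered.feasible I0 pstar next ℓ k).Nonempty ∧
          (loop ℓ).α / γ ≤
            (loop ℓ).minCost pstar (x ℓ k) (SelfTriggered.feasible I0 pstar next ℓ k)) ∧
        ∀ δ > 0, ∀ᶠ k in Filter.atTop, SelfTriggered.IsSampled next ℓ k →
          (loop ℓ).minCost pstar (x ℓ k) (SelfTriggered.feasible I0 pstar next ℓ k) ≤
            (loop ℓ).α / ε * (1 / pstar - (1 - ε) * (1 / γ)) + δ := by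
  have hpI := hp.1.1
  have hT := fun ℓ => SelfTriggered.Loop.terminalP_isRiccatiSolution (hQ ℓ) (hR ℓ)
    (hI0 _ hpI) (hdown ℓ)
  refine ⟨fun ℓ => SelfTriggered.Loop.existsUnique_isRiccatiSolution (hQ ℓ) (hR ℓ)
    (hI0 _ hpI) (hdown ℓ), fun tie htie x₀ => SelfTriggered.exists_isRun hL hsp htie x₀,
    fun ℓ => ?_⟩
  obtain ⟨ε, hε⟩ := SelfTriggered.Loop.exists_isGreatest_contractionSet (hQ ℓ) (hR ℓ) hpI hI0
    (hT ℓ)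
  refine ⟨ε, hε, fun x u next h => ⟨h.frequently_isSampled hI0 ℓ, fun k hs =>
    ⟨SelfTriggered.feasible_nonempty hL hsp next ℓ k, ?_⟩, fun δ hδ => ?_⟩⟩
  · exact h.le_minCost hI0 (fun i hi => hγ.2 hi) (hα ℓ) (hQ ℓ) (hR ℓ) (hT ℓ) hs
  · exact h.eventually_minCost_le hpI hI0 (fun i hi => hγ.2 hi) (hα ℓ) (hQ ℓ) (hR ℓ) (hT ℓ)
      hε.1 hδ
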